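/- Let $K$ be a field of characteristic $0$ with algebraic closure $\overline K$. For a $K$-algebra $A$ put $\overline A=\overline K\otimes_K A$ and regard $A\subseteq\overline A$ via $a\mapsto 1\otimes a$. For a $K$-derivation $\delta$ of $A$ (extended $\overline K$-linearly to $\overline A$) let $$C(\delta)=\ker\delta,\qquad N(\delta)=\bigcup_{i\ge 0}\ker\delta^{i+1},\qquad D(\delta)=A\cap\bigoplus_{\lambda\in\overline K}\{b\in\overline A:\delta(b)=\lambda b\},$$ $$F(\delta)=\{b\in A:\dim_K K[\delta]b<\infty\}.$$ For $a\in A$ let $\mathrm{ad}\,a$ be the inner derivation $b\mapsto ab-ba$, and write $C(a),N(a),D(a),F(a)$ for $C(\mathrm{ad}\,a)$, etc. Let $Z(A)$ be the centre of $A$, and let $\Delta_i(A)$, $1\le i\le 5$, be the sets of those $a\in A\setminus Z(A)$ which satisfy, respectively: - $\Delta_1(A)$ (strongly nilpotent): $N(a)=A$ and $D(a)=C(a)$; - $\Delta_2(A)$ (weakly nilpotent): $C(a)\ne N(a)\ne A$ and $D(a)=C(a)$; - $\Delta_3(A)$ (strongly semi-simple): $N(a)=C(a)$ and $D(a)=A$;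 - $\Delta_4(A)$ (weakly semi-simple): $N(a)=C(a)$ and $C(a)\ne D(a)=F(a)\ne A$; - $\Delta_5(A)$ (generic): $N(a)=D(a)=C(a)$. Let $A_1=K\langle x,\partial \mid \partial x-x\partial=1\rangle$ be the first Weyl algebra over $K$. Then: (a) (Affirmative answer to Dixmier's problem 6.) If $a\in\Delta_5(A_1)$, then $K[a]\setminus K\subseteq\Delta_5(A_1)$. (b) Let $f(t)\in K[t]$ be a polynomial of degree $>1$ and let $a\in A_1$. 1. For $i=1,2,5$: if $a\in\Delta_i(A_1)$, then $f(a)\in\Delta_i(A_1)$. 2. For $i=3,4$: if $a\in\Delta_i(A_1)$, then $f(a)\in\Delta_5(A_1)$. -/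

import Mathlib

open scoped TensorProduct

/-- The defining relation `∂ x = x ∂ + 1` of the first Weyl algebra, in the free algebra on the
two generators `x = ι 0` and `∂ = ι 1`. -/
inductive WeylRel (K : Type*) [Field K] :
    FreeAlgebra K (Fin 2) → FreeAlgebra K (Fin 2) → Prop
  | comm : WeylRel K (FreeAlgebra.ι K 1 * FreeAlgebra.ι K 0)
      (FreeAlgebra.ι K 0 * FreeAlgebra.ι K 1 + 1)

/-- The first Weyl algebra `A₁ = K⟨x, ∂ | ∂ x - x ∂ = 1⟩`. -/
abbrev WeylAlgebra (K : Type*) [Field K] : Type _ := RingQuot (WeylRel K)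

namespace Dixmier

section Endomorphism

variable {K : Type*} [Field K] {A : Type*} [Ring A] [Algebra K A]

/-- The kernel `C(δ) = ker δ`. -/
def kerAlg (δ : Module.End K A) : Submodule K A := LinearMap.ker δ

/-- The nil-algebra `N(δ) = ⋃ i, ker δ^(i+1)` (an increasing union, hence a supremum). -/
def nilAlg (δ : Module.End K A) : Submodule K A := ⨆ i : ℕ, LinearMap.ker (δ ^ (i + 1))

/-- The sum of all eigenspaces of (the extension of) `δ` in `K̄ ⊗ A`, where `K̄` is the algebraic
closure of `K`. -/
noncomputable def eigAlgClosure (δ : Module.End K A) :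
    Submodule (AlgebraicClosure K) (AlgebraicClosure K ⊗[K] A) :=
  ⨆ μ : AlgebraicClosure K,
    Module.End.eigenspace (LinearMap.baseChange (AlgebraicClosure K) δ) μ

/-- The eigenvalue algebra `D(δ) = A ∩ D(δ, K̄ ⊗ A)`, where `A` is embedded in `K̄ ⊗ A` by
`a ↦ 1 ⊗ a`. -/
noncomputable def eigAlg (δ : Module.End K A) : Submodule K A :=
  ((eigAlgClosure δ).restrictScalars K).comap (TensorProduct.mk K (AlgebraicClosure K) A 1)

/-- The cyclic `K[δ]`-submodule `K[δ] a`. -/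
def cyclic (δ : Module.End K A) (a : A) : Submodule K A :=
  Submodule.span K (Set.range fun n : ℕ => (δ ^ n) a)

/-- The torsion algebra `F(δ) = {a | dim_K K[δ] a < ∞}`. -/
def torAlg (δ : Module.End K A) : Submodule K A where
  carrier := {a | FiniteDimensional K (cyclic δ a)}
  zero_mem' := by
    have h : cyclic δ (0 : A) = ⊥ := by simp [cyclic]
    show FiniteDimensional K (cyclic δ (0 : A))
    rw [h]
    infer_instance
  add_mem' := by
    intro a b (ha : FiniteDimensional K (cyclic δ a)) (hb : FiniteDimensional K (cyclic δ b))
    refine Submodule.finiteDimensional_of_le (S₂ := cyclic δ a ⊔ cyclic δ b) ?_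
    refine Submodule.span_le.2 ?_
    rintro _ ⟨n, rfl⟩
    simp only [map_add]
    exact Submodule.add_mem_sup (Submodule.subset_span ⟨n, rfl⟩) (Submodule.subset_span ⟨n, rfl⟩)
  smul_mem' := by
    intro c a (ha : FiniteDimensional K (cyclic δ a))
    refine Submodule.finiteDimensional_of_le (S₂ := cyclic δ a) ?_
    refine Submodule.span_le.2 ?_
    rintro _ ⟨n, rfl⟩
    simp only [map_smul]
    exact Submodule.smul_mem _ c (Submodule.subset_span ⟨n, rfl⟩)

def StronglyNilpotent (δ : Module.End K A) : Prop :=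
  nilAlg δ = ⊤ ∧ eigAlg δ = kerAlg δ

def WeaklyNilpotent (δ : Module.End K A) : Prop :=
  kerAlg δ ≠ nilAlg δ ∧ nilAlg δ ≠ ⊤ ∧ eigAlg δ = kerAlg δ

def StronglySemisimple (δ : Module.End K A) : Prop :=
  nilAlg δ = kerAlg δ ∧ eigAlg δ = ⊤

def WeaklySemisimple (δ : Module.End K A) : Prop :=
  nilAlg δ = kerAlg δ ∧ kerAlg δ ≠ eigAlg δ ∧ eigAlg δ = torAlg δ ∧ torAlg δ ≠ ⊤

def Generic (δ : Module.End K A) : Prop :=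
  nilAlg δ = eigAlg δ ∧ eigAlg δ = kerAlg δ

end Endomorphism

section Elements

variable (K : Type*) [Field K] (A : Type*) [Ring A] [Algebra K A]

/-- The inner derivation `ad a : b ↦ a b - b a`. -/
def ad (a : A) : Module.End K A := LinearMap.mulLeft K a - LinearMap.mulRight K a

/-- `Δ₁(A)`: the noncentral `a` with `ad a` strongly nilpotent. -/
def Delta₁ : Set A := {a | a ∉ Subalgebra.center K A ∧ StronglyNilpotent (ad K A a)}

/-- `Δ₂(A)`: the noncentral `a` with `ad a` weakly nilpotent. -/
def Delta₂ : Set A := {a | a ∉ Subalgebra.center K A ∧ WeaklyNilpotent (ad K A a)}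

/-- `Δ₃(A)`: the noncentral `a` with `ad a` strongly semi-simple. -/
def Delta₃ : Set A := {a | a ∉ Subalgebra.center K A ∧ StronglySemisimple (ad K A a)}

/-- `Δ₄(A)`: the noncentral `a` with `ad a` weakly semi-simple. -/
def Delta₄ : Set A := {a | a ∉ Subalgebra.center K A ∧ WeaklySemisimple (ad K A a)}

/-- `Δ₅(A)`: the noncentral `a` with `ad a` generic. -/
def Delta₅ : Set A := {a | a ∉ Subalgebra.center K A ∧ Generic (ad K A a)}

end Elements

end Dixmier

/-! Write elements of `A₁` in normal order and let σ be the resulting symbol in `K[X][Y]`, filtered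
by the degree in `Y` (the order). Symbols multiply up to lower order, so modulo lower order σ([f(a),
c]) = f'(σ(a)) σ([a, c]). In characteristic 0, for noncentral `a` and [a, c] ≠ 0, this gives ord
[f(a), c] = (deg f - 1) ord a + ord [a, c] (`degree_symbol_commutator_aeval`).

Hence `a` and `f(a)` have the same centralizer, and since their inner derivations commute, also the
same N. If deg f > 1, then ad f(a) has no nonzero eigenvalue: were [f(a), c] = r c with r, c ≠ 0,
then [a, c] would be another eigenvector for r, of smaller order when ord a > 0, and descent ends in
a contradiction (`eq_zero_of_commutator_aeval_eq_smul`). Applied over the algebraic closure this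
gives D(f(a)) = C(a), whatever D(a) is. All cases follow from C and N being kept and D collapsing to
C. -/

namespace WeylAlgebra

open Polynomial

variable {K : Type*} [Field K]

/-! ### Generators, universal property and induction. -/

section Presentation

variable (K) in
/-- The generator `x`. -/
noncomputable def genX : WeylAlgebra K := RingQuot.mkAlgHom K (WeylRel K) (FreeAlgebra.ι K 0)

variable (K) in
/-- The generator `∂`. -/
noncomputable def genD : WeylAlgebra K := RingQuot.mkAlgHom K (WeylRel K) (FreeAlgebra.ι K 1)

theorem genD_mul_genX : genD K * genX K = genX K * genD K + 1 := by
  simpa [genX, genD] using RingQuot.mkAlgHom_rel K (WeylRel.comm (K := K))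

/-- The algebra homomorphism determined by the images of `x` and `∂`. -/
noncomputable def liftGen {B : Type*} [Semiring B] [Algebra K B] (u v : B)
    (h : v * u = u * v + 1) : WeylAlgebra K →ₐ[K] B :=
  RingQuot.liftAlgHom K ⟨FreeAlgebra.lift K ![u, v], by
    rintro _ _ ⟨⟩
    simpa using h⟩

@[simp] theorem liftGen_genX {B : Type*} [Semiring B] [Algebra K B] (u v : B)
    (h : v * u = u * v + 1) : liftGen (K := K) u v h (genX K) = u := by
  simp [liftGen, genX]

@[simp] theorem liftGen_genD {B : Type*} [Semiring B] [Algebra K B] (u v : B)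
    (h : v * u = u * v + 1) : liftGen (K := K) u v h (genD K) = v := by
  simp [liftGen, genD]

theorem algHom_ext_gen {B : Type*} [Semiring B] [Algebra K B] {f g : WeylAlgebra K →ₐ[K] B}
    (hx : f (genX K) = g (genX K)) (hd : f (genD K) = g (genD K)) : f = g := by
  apply RingQuot.ringQuot_ext'
  apply FreeAlgebra.hom_ext
  funext i
  fin_cases i
  · exact hx
  · exact hd

theorem induction_gen {p : WeylAlgebra K → Prop} (halg : ∀ r, p (algebraMap K _ r))
    (hx : p (genX K)) (hd : p (genD K)) (hmul : ∀ a b, p a → p b → p (a * b))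
    (hadd : ∀ a b, p a → p b → p (a + b)) (a : WeylAlgebra K) : p a := by
  obtain ⟨a, rfl⟩ := RingQuot.mkAlgHom_surjective K (WeylRel K) a
  induction a with
  | grade0 r => rw [AlgHom.commutes]; exact halg r
  | grade1 i =>
    fin_cases i
    · exact hx
    · exact hd
  | mul a b ha hb => rw [map_mul]; exact hmul _ _ ha hb
  | add a b ha hb => rw [map_add]; exact hadd _ _ ha hb

end Presentation

/-! ### Normal ordering and the filtration by order in `∂`. -/

section Symbol

theorem coeff_sum_monomial_derivative (p : K[X][X]) (n : ℕ) :
    (∑ k ∈ p.support, monomial k (derivative (p.coeff k))).coeff n = derivative (p.coeff n) := by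
  simp only [finsetSum_coeff, coeff_monomial, Finset.sum_ite_eq', mem_support_iff, ne_eq]
  split_ifs with h
  · rfl
  · rw [notMem_support_iff.1 h, derivative_zero]

variable (K) in
/-- Differentiation of the coefficients in `K[X][Y]`. -/
noncomputable def dX : Module.End K K[X][X] where
  toFun p := ∑ n ∈ p.support, monomial n (derivative (p.coeff n))
  map_add' p q := by
    ext n : 1
    rw [coeff_sum_monomial_derivative, coeff_add, coeff_add, coeff_sum_monomial_derivative,
      coeff_sum_monomial_derivative, derivative_add]
  map_smul' c p := by
    ext n : 1
    rw [coeff_sum_monomial_derivative, coeff_smul, RingHom.id_apply, coeff_smul,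
      coeff_sum_monomial_derivative, derivative_smul]

@[simp] theorem coeff_dX (p : K[X][X]) (n : ℕ) : (dX K p).coeff n = derivative (p.coeff n) :=
  coeff_sum_monomial_derivative p n

theorem dX_C_X_mul (p : K[X][X]) : dX K (C X * p) = p + C X * dX K p := by
  ext n : 1
  simp [coeff_C_mul, derivative_mul]

variable (K) in
/-- The action of `∂` on normally ordered symbols: `p ↦ Y p + dX p`. -/
noncomputable def opD : Module.End K K[X][X] :=
  LinearMap.mulLeft K (X : K[X][X]) + dX K

theorem opD_apply (p : K[X][X]) : opD K p = X * p + dX K p := rfl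

variable (K) in
/-- The action of the Weyl algebra on normally ordered symbols by left multiplication. -/
noncomputable def symbolRep : WeylAlgebra K →ₐ[K] Module.End K K[X][X] :=
  liftGen (LinearMap.mulLeft K (C X : K[X][X])) (opD K) (by
    refine LinearMap.ext fun p => ?_
    simp only [Module.End.mul_apply, LinearMap.add_apply, LinearMap.mulLeft_apply, opD_apply,
      Module.End.one_apply, dX_C_X_mul]
    ring)

variable (K) in
/-- The normally ordered symbol: `∑ pᵢ(x) ∂ⁱ ↦ ∑ pᵢ(X) Yⁱ`. -/
noncomputable def symbol : WeylAlgebra K →ₗ[K] K[X][X] :=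
  (LinearMap.applyₗ (1 : K[X][X])).comp (symbolRep K).toLinearMap

theorem symbol_apply (a : WeylAlgebra K) : symbol K a = symbolRep K a 1 := rfl

theorem symbol_mul (a b : WeylAlgebra K) : symbol K (a * b) = symbolRep K a (symbol K b) := by
  simp [symbol_apply]

@[simp] theorem symbol_one : symbol K 1 = 1 := by simp [symbol_apply]

variable (K) in
/-- Quantization: `∑ pᵢ(X) Yⁱ ↦ ∑ pᵢ(x) ∂ⁱ`. -/
noncomputable def quantize : K[X][X] →ₗ[K] WeylAlgebra K where
  toFun p := p.sum fun i q => aeval (genX K) q * genD K ^ i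
  map_add' p q := by
    rw [Polynomial.sum_add_index] <;> simp [add_mul]
  map_smul' c p := by
    rw [Polynomial.sum_smul_index' p c _ (by simp), RingHom.id_apply, Polynomial.sum_def,
      Polynomial.sum_def, Finset.smul_sum]
    simp

theorem quantize_monomial (i : ℕ) (q : K[X]) :
    quantize K (monomial i q) = aeval (genX K) q * genD K ^ i := by
  simp [quantize, Polynomial.sum_monomial_index]

theorem symbolRep_aeval_genX (q : K[X]) :
    symbolRep K (aeval (genX K) q) = LinearMap.mulLeft K (C q : K[X][X]) := by
  have h : (symbolRep K).comp (aeval (genX K)) =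
      (Algebra.lmul K K[X][X]).comp (CAlgHom (R := K) (A := K[X])) := by
    ext
    simp [symbolRep]
  exact DFunLike.congr_fun h q

theorem symbolRep_genD_pow (i : ℕ) : symbolRep K (genD K ^ i) = opD K ^ i := by
  simp [symbolRep]

theorem opD_pow_one (i : ℕ) : (opD K ^ i) 1 = X ^ i := by
  induction i with
  | zero => simp
  | succ i ih =>
    have h : dX K (X ^ i) = 0 := by
      ext n : 1
      rw [coeff_dX, coeff_X_pow]
      split_ifs <;> simp
    rw [pow_succ', Module.End.mul_apply, ih, opD_apply, h, add_zero, pow_succ']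

theorem symbol_quantize (p : K[X][X]) : symbol K (quantize K p) = p := by
  induction p using Polynomial.induction_on' with
  | add p q hp hq => rw [map_add, map_add, hp, hq]
  | monomial i q =>
    rw [quantize_monomial, symbol_apply, map_mul, symbolRep_aeval_genX, symbolRep_genD_pow,
      Module.End.mul_apply, opD_pow_one, LinearMap.mulLeft_apply, C_mul_X_pow_eq_monomial]

theorem genD_mul_aeval_genX (q : K[X]) :
    genD K * aeval (genX K) q =
      aeval (genX K) q * genD K + aeval (genX K) (derivative q) := by
  induction q using Polynomial.induction_on with
  | C r => simp [Algebra.commutes]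
  | add p q hp hq => simp only [map_add, mul_add, hp, hq, add_mul]; abel
  | monomial n r h =>
    have e : (C r * X ^ (n + 1) : K[X]) = (C r * X ^ n) * X := by rw [pow_succ, mul_assoc]
    rw [e, map_mul, ← mul_assoc, h, derivative_mul (g := X), derivative_X, mul_one, map_add,
      map_mul (aeval (genX K)) (derivative _), aeval_X, add_mul, mul_assoc, genD_mul_genX, mul_add, mul_one, mul_assoc]
    abel

/-- The range contains `1` and is stable under left multiplication by the generators. With
`symbol_quantize` this makes `quantize` and `symbol` mutually inverse, so normal forms exist and are
unique. -/
theorem quantize_surjective : Function.Surjective (quantize K) := by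
  suffices h : ∀ a : WeylAlgebra K, ∀ p, a * quantize K p ∈ LinearMap.range (quantize K) by
    intro a
    have := h a (monomial 0 1)
    rwa [quantize_monomial, map_one, pow_zero, mul_one, mul_one] at this
  intro a
  induction a using induction_gen with
  | halg r =>
    intro p
    rw [← Algebra.smul_def]
    exact Submodule.smul_mem _ _ ⟨p, rfl⟩
  | hmul a b ha hb =>
    intro p
    obtain ⟨q, hq⟩ := hb p
    rw [mul_assoc, ← hq]
    exact ha q
  | hadd a b ha hb =>
    intro p
    rw [add_mul]
    exact add_mem (ha p) (hb p)
  | hx =>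
    intro p
    induction p using Polynomial.induction_on' with
    | add p q hp hq => rw [map_add, mul_add]; exact add_mem hp hq
    | monomial i q =>
      refine ⟨monomial i (X * q), ?_⟩
      simp [quantize_monomial, mul_assoc]
  | hd =>
    intro p
    induction p using Polynomial.induction_on' with
    | add p q hp hq => rw [map_add, mul_add]; exact add_mem hp hq
    | monomial i q =>
      refine ⟨monomial (i + 1) q + monomial i (derivative q), ?_⟩
      rw [map_add]
      simp only [quantize_monomial]
      rw [← mul_assoc, genD_mul_aeval_genX, add_mul, pow_succ', ← mul_assoc]

theorem symbol_injective : Function.Injective (symbol K) := by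
  intro a b h
  obtain ⟨p, rfl⟩ := quantize_surjective a
  obtain ⟨q, rfl⟩ := quantize_surjective b
  rw [symbol_quantize, symbol_quantize] at h
  rw [h]

theorem dX_mem_degreeLT {n : ℕ} {p : K[X][X]} (hp : p ∈ degreeLT K[X] n) :
    dX K p ∈ degreeLT K[X] n := by
  rw [mem_degreeLT, degree_lt_iff_coeff_zero] at hp ⊢
  intro m hm
  simp [hp m hm]

theorem X_mul_mem_degreeLT {n : ℕ} {p : K[X][X]} (hp : p ∈ degreeLT K[X] n) :
    X * p ∈ degreeLT K[X] (n + 1) := by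
  rw [mem_degreeLT, degree_lt_iff_coeff_zero] at hp ⊢
  intro m hm
  obtain ⟨m, rfl⟩ : ∃ k, m = k + 1 := ⟨m - 1, by omega⟩
  rw [coeff_X_mul]
  exact hp m (by omega)

/-- The bounds are asymmetric: degree at most `i` times degree below `j`. This lets error terms be
multiplied without truncated subtraction. -/
theorem mul_mem_degreeLT {i j : ℕ} {p q : K[X][X]} (hp : p ∈ degreeLT K[X] (i + 1))
    (hq : q ∈ degreeLT K[X] j) : p * q ∈ degreeLT K[X] (i + j) := by
  rw [mem_degreeLT, degree_lt_iff_coeff_zero] at hp hq ⊢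
  intro m hm
  rw [coeff_mul]
  refine Finset.sum_eq_zero fun x hx => ?_
  have hx := Finset.HasAntidiagonal.mem_antidiagonal.1 hx
  rcases Nat.lt_or_ge i x.1 with h | h
  · rw [hp _ h, zero_mul]
  · rw [hq _ (by omega), mul_zero]

/-- `opD` is multiplication by `Y` plus `dX`, and `dX` does not raise the degree in `Y`; each use of
`dX` in place of `Y` loses one degree. -/
theorem opD_pow_sub_mem {j : ℕ} {p : K[X][X]} (hp : p ∈ degreeLT K[X] (j + 1)) (i : ℕ) :
    (opD K ^ i) p - X ^ i * p ∈ degreeLT K[X] (i + j) := by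
  induction i with
  | zero => simp
  | succ i ih =>
    have h1 : X ^ i * p ∈ degreeLT K[X] (i + (j + 1)) :=
      mul_mem_degreeLT (by rw [mem_degreeLT, degree_X_pow]; exact_mod_cast Nat.lt_succ_self i) hp
    have h2 : (opD K ^ i) p ∈ degreeLT K[X] (i + (j + 1)) := by
      have := add_mem (degreeLT_mono (by omega : i + j ≤ i + (j + 1)) ih) h1
      rwa [sub_add_cancel] at this
    have e : (opD K ^ (i + 1)) p - X ^ (i + 1) * p =
        X * ((opD K ^ i) p - X ^ i * p) + dX K ((opD K ^ i) p) := by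
      rw [pow_succ' (opD K), Module.End.mul_apply, opD_apply]
      ring
    rw [e, show i + 1 + j = i + j + 1 by omega]
    exact add_mem (X_mul_mem_degreeLT ih) (dX_mem_degreeLT h2)

/-- The symbol is multiplicative up to terms of lower order. -/
theorem symbol_mul_sub_mem {i j : ℕ} {a b : WeylAlgebra K}
    (ha : symbol K a ∈ degreeLT K[X] (i + 1)) (hb : symbol K b ∈ degreeLT K[X] (j + 1)) :
    symbol K (a * b) - symbol K a * symbol K b ∈ degreeLT K[X] (i + j) := by
  obtain ⟨p, rfl⟩ := quantize_surjective a
  rw [symbol_quantize] at ha ⊢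
  rw [symbol_mul]
  have e : symbolRep K (quantize K p) (symbol K b) - p * symbol K b =
      p.sum fun k q => C q * ((opD K ^ k) (symbol K b) - X ^ k * symbol K b) := by
    clear ha
    induction p using Polynomial.induction_on' with
    | add p q hp hq =>
      rw [Polynomial.sum_add_index _ _ _ (by simp) (by simp [add_mul]), ← hp, ← hq, map_add,
        map_add, LinearMap.add_apply]
      ring
    | monomial k q =>
      rw [quantize_monomial, map_mul, symbolRep_aeval_genX, symbolRep_genD_pow,
        Polynomial.sum_monomial_index _ _ (by simp), ← C_mul_X_pow_eq_monomial]
      simp [mul_sub, mul_assoc]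
  rw [e, Polynomial.sum_def]
  refine Submodule.sum_mem _ fun k hk => ?_
  rw [← smul_eq_C_mul]
  refine Submodule.smul_mem _ _ (degreeLT_mono ?_ (opD_pow_sub_mem hb k))
  rw [mem_degreeLT] at ha
  have := (le_degree_of_mem_supp _ hk).trans_lt ha
  have : k < i + 1 := by exact_mod_cast this
  omega

end Symbol

end WeylAlgebra

namespace WeylAlgebra

open Polynomial

variable {K : Type*} [Field K]

/-! ### Symbols of commutators with `f(a)`, centralizers and eigenvectors. -/

section Commutator

theorem commute_aeval {A : Type*} [Semiring A] [Algebra K A] {a c : A} (h : Commute a c)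
    (f : K[X]) : Commute (aeval a f) c := by
  rw [aeval_eq_sum_range]
  exact Commute.sum_left _ _ _ fun i _ => (h.pow_left i).smul_left _

theorem mem_degreeLT_succ_natDegree (p : K[X][X]) : p ∈ degreeLT K[X] (p.natDegree + 1) :=
  mem_degreeLT.2 (degree_le_natDegree.trans_lt (by exact_mod_cast Nat.lt_succ_self _))

theorem pow_mem_degreeLT {i : ℕ} {p : K[X][X]} (hp : p ∈ degreeLT K[X] (i + 1)) (k : ℕ) :
    p ^ k ∈ degreeLT K[X] (k * i + 1) := by
  induction k with
  | zero => simp [mem_degreeLT]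
  | succ k ih =>
    rw [pow_succ, show (k + 1) * i + 1 = k * i + (i + 1) by ring]
    exact mul_mem_degreeLT (i := k * i) (j := i + 1) ih hp

theorem symbol_mul_mem {i j : ℕ} {a b : WeylAlgebra K}
    (ha : symbol K a ∈ degreeLT K[X] (i + 1)) (hb : symbol K b ∈ degreeLT K[X] (j + 1)) :
    symbol K (a * b) ∈ degreeLT K[X] (i + j + 1) := by
  have h1 : symbol K a * symbol K b ∈ degreeLT K[X] (i + j + 1) :=
    mul_mem_degreeLT (j := j + 1) ha hb
  have h := add_mem (degreeLT_mono (Nat.le_succ _) (symbol_mul_sub_mem ha hb)) h1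
  rwa [sub_add_cancel] at h

/-- Commutators drop the order. -/
theorem symbol_commutator_mem {i j : ℕ} {a b : WeylAlgebra K}
    (ha : symbol K a ∈ degreeLT K[X] (i + 1)) (hb : symbol K b ∈ degreeLT K[X] (j + 1)) :
    symbol K (a * b - b * a) ∈ degreeLT K[X] (i + j) := by
  have h := sub_mem (symbol_mul_sub_mem ha hb)
    (by simpa only [add_comm j i] using symbol_mul_sub_mem hb ha)
  rwa [mul_comm (symbol K b), sub_sub_sub_cancel_right, ← map_sub] at h

theorem symbol_pow_mem {i : ℕ} {a : WeylAlgebra K} (ha : symbol K a ∈ degreeLT K[X] (i + 1))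
    (k : ℕ) : symbol K (a ^ k) ∈ degreeLT K[X] (k * i + 1) := by
  induction k with
  | zero => simp [mem_degreeLT]
  | succ k ih =>
    rw [pow_succ, show (k + 1) * i + 1 = k * i + i + 1 by ring]
    exact symbol_mul_mem ih ha

theorem symbol_pow_sub_mem {i : ℕ} {a : WeylAlgebra K}
    (ha : symbol K a ∈ degreeLT K[X] (i + 1)) (k : ℕ) :
    symbol K (a ^ k) - symbol K a ^ k ∈ degreeLT K[X] (k * i) := by
  induction k with
  | zero => simp
  | succ k ih =>
    have h1 := symbol_mul_sub_mem (symbol_pow_mem ha k) ha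
    have h2 := mul_mem_degreeLT ha ih
    have e : symbol K (a ^ (k + 1)) - symbol K a ^ (k + 1) =
        (symbol K (a ^ k * a) - symbol K (a ^ k) * symbol K a) +
          symbol K a * (symbol K (a ^ k) - symbol K a ^ k) := by
      rw [pow_succ, pow_succ]
      ring
    rw [e, show (k + 1) * i = k * i + i by ring]
    exact add_mem h1 (by rwa [add_comm] at h2)

/-- Leibniz: [a^(k+2), c] = a [a^(k+1), c] + [a, c] a^(k+1), and the factors commute on the level of
symbols. -/
theorem symbol_commutator_pow {i s : ℕ} {a c : WeylAlgebra K}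
    (ha : symbol K a ∈ degreeLT K[X] (i + 1))
    (he : symbol K (a * c - c * a) ∈ degreeLT K[X] (s + 1)) (k : ℕ) :
    symbol K (a ^ (k + 1) * c - c * a ^ (k + 1)) -
      ((k : K[X][X]) + 1) * symbol K a ^ k * symbol K (a * c - c * a) ∈
        degreeLT K[X] (k * i + s) := by
  induction k with
  | zero => simp
  | succ k ih =>
    set e := a * c - c * a with he_def
    set u := a ^ (k + 1) * c - c * a ^ (k + 1) with hu_def
    have hk : ((k : K[X][X]) + 1) * symbol K a ^ k * symbol K e ∈
        degreeLT K[X] (k * i + (s + 1)) := by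
      rw [mul_assoc, ← Nat.cast_succ, ← nsmul_eq_mul]
      exact nsmul_mem (mul_mem_degreeLT (pow_mem_degreeLT ha k) he) _
    have hu : symbol K u ∈ degreeLT K[X] (k * i + s + 1) := by
      have := add_mem (degreeLT_mono (by omega) ih) hk
      rwa [sub_add_cancel] at this
    have h1 := symbol_mul_sub_mem ha hu
    have h2 := mul_mem_degreeLT ha ih
    have h3 := symbol_mul_sub_mem he (symbol_pow_mem ha (k + 1))
    have h4 := mul_mem_degreeLT he (symbol_pow_sub_mem ha (k + 1))
    have e1 : a ^ (k + 1 + 1) * c - c * a ^ (k + 1 + 1) = a * u + e * a ^ (k + 1) := by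
      rw [hu_def, he_def, pow_succ' a (k + 1), mul_sub, sub_mul]
      simp only [mul_assoc]
      abel
    have e2 : symbol K (a * u + e * a ^ (k + 1)) -
        (((k + 1 : ℕ) : K[X][X]) + 1) * symbol K a ^ (k + 1) * symbol K e =
        (symbol K (a * u) - symbol K a * symbol K u) +
        symbol K a * (symbol K u - ((k : K[X][X]) + 1) * symbol K a ^ k * symbol K e) +
        ((symbol K (e * a ^ (k + 1)) - symbol K e * symbol K (a ^ (k + 1))) +
        symbol K e * (symbol K (a ^ (k + 1)) - symbol K a ^ (k + 1))) := by
      rw [map_add]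
      push_cast
      ring
    rw [e1, e2]
    have n1 : (k + 1) * i + s = i + (k * i + s) := by ring
    have n2 : (k + 1) * i + s = s + (k + 1) * i := by ring
    refine add_mem ?_ ?_
    · rw [n1]; exact add_mem h1 h2
    · rw [n2]; exact add_mem h3 h4

/-- The symbol of `[f(a), c]` is `f'(σ(a)) σ([a, c])` up to lower order. -/
theorem symbol_commutator_aeval {i s m : ℕ} {a c : WeylAlgebra K}
    (ha : symbol K a ∈ degreeLT K[X] (i + 1))
    (he : symbol K (a * c - c * a) ∈ degreeLT K[X] (s + 1)) (f : K[X])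
    (hf : f.natDegree ≤ m + 1) :
    symbol K (aeval a f * c - c * aeval a f) -
      aeval (symbol K a) (derivative f) * symbol K (a * c - c * a) ∈
        degreeLT K[X] (m * i + s) := by
  -- Only monomials of degree at most `m + 1` occur, so one error bound serves every summand.
  refine induction_with_natDegree_le (fun f => symbol K (aeval a f * c - c * aeval a f) -
    aeval (symbol K a) (derivative f) * symbol K (a * c - c * a) ∈ degreeLT K[X] (m * i + s))
    (m + 1) (by simp) (fun n r _ hn => ?_) (fun f g _ _ hf hg => ?_) f hf
  · rcases n with _ | n
    · simp [Algebra.commutes]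
    · have h := degreeLT_mono (Nat.add_le_add_right (Nat.mul_le_mul_right i
        (Nat.le_of_succ_le_succ hn)) s) (symbol_commutator_pow ha he n)
      have h := ((degreeLT K[X] (m * i + s)).restrictScalars K).smul_mem r h
      have e1 : aeval a (C r * X ^ (n + 1)) * c - c * aeval a (C r * X ^ (n + 1)) =
          r • (a ^ (n + 1) * c - c * a ^ (n + 1)) := by
        rw [← smul_eq_C_mul, map_smul, map_pow, aeval_X, smul_mul_assoc, mul_smul_comm, smul_sub]
      have e2 : aeval (symbol K a) (derivative (C r * X ^ (n + 1))) =
          r • (((n : K[X][X]) + 1) * symbol K a ^ n) := by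
        simp [← smul_eq_C_mul]
      show symbol K _ - _ ∈ _
      rw [e1, e2, map_smul, smul_mul_assoc, ← smul_sub]
      exact h
  · have h := add_mem hf hg
    rw [← add_sub_add_comm, ← map_add, ← add_mul, ← map_add, ← derivative_add] at h
    show symbol K _ - _ ∈ _
    convert h using 3
    rw [map_add, add_mul, mul_add]
    abel

theorem symbol_ne_const {a b : WeylAlgebra K} (hab : a * b ≠ b * a) (r : K) :
    symbol K a ≠ C (C r) := by
  intro h
  have : a = algebraMap K _ r := by
    apply symbol_injective
    rw [h, Algebra.algebraMap_eq_smul_one, map_smul, symbol_one, ← C_1, smul_C, ← C_1, smul_C,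
      smul_eq_mul, mul_one]
  exact hab (this ▸ Algebra.commutes r b)

variable [CharZero K]

theorem natDegree_aeval_derivative {A : K[X][X]} (f : K[X]) :
    (aeval A (derivative f)).natDegree = (f.natDegree - 1) * A.natDegree := by
  have e : aeval A (derivative f) = ((derivative f).map (C : K →+* K[X])).comp A := by
    rw [comp, eval₂_map, aeval_def]
    rfl
  rw [e, natDegree_comp, natDegree_map, natDegree_derivative]

/-- A root of a nonzero polynomial over `K` is constant in `Y`, then constant in `X`. -/
theorem aeval_derivative_ne_zero {A : K[X][X]} (hA : ∀ r : K, A ≠ C (C r)) {f : K[X]}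
    (hf : 0 < f.natDegree) : aeval A (derivative f) ≠ 0 := by
  have e : aeval A (derivative f) = ((derivative f).map (C : K →+* K[X])).comp A := by
    rw [comp, eval₂_map, aeval_def]
    rfl
  have hd : derivative f ≠ 0 := fun h => hf.ne' (derivative_eq_zero.1 h)
  rw [e, Ne, comp_eq_zero_iff, Polynomial.map_eq_zero]
  rintro (h | ⟨h, h'⟩)
  · exact hd h
  · rw [eval_map, ← comp, comp_eq_zero_iff] at h
    rcases h with h | ⟨-, h⟩
    · exact hd h
    · rw [h] at h'
      exact hA _ h'

theorem degree_symbol_commutator_aeval {a b c : WeylAlgebra K} (hab : a * b ≠ b * a)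
    {f : K[X]} (hf : 0 < f.natDegree) (hc : a * c - c * a ≠ 0) :
    (symbol K (aeval a f * c - c * aeval a f)).degree =
      (((f.natDegree - 1) * (symbol K a).natDegree + (symbol K (a * c - c * a)).natDegree : ℕ) :
        WithBot ℕ) := by
  have h := symbol_commutator_aeval (mem_degreeLT_succ_natDegree (symbol K a))
    (mem_degreeLT_succ_natDegree (symbol K (a * c - c * a))) f
    (m := f.natDegree - 1) (by omega)
  have he : symbol K (a * c - c * a) ≠ 0 := by
    rwa [Ne, map_eq_zero_iff _ symbol_injective]
  have hG := aeval_derivative_ne_zero (symbol_ne_const hab) hf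
  have hd : (aeval (symbol K a) (derivative f) * symbol K (a * c - c * a)).degree =
      (((f.natDegree - 1) * (symbol K a).natDegree + (symbol K (a * c - c * a)).natDegree : ℕ) :
        WithBot ℕ) := by
    rw [degree_eq_natDegree (mul_ne_zero hG he), natDegree_mul hG he, natDegree_aeval_derivative]
  rw [mem_degreeLT, ← hd] at h
  rw [← hd]
  have := degree_add_eq_right_of_degree_lt h
  rwa [sub_add_cancel] at this

theorem commute_of_commute_aeval {a c : WeylAlgebra K} {f : K[X]}
    (hf : 0 < f.natDegree) (h : aeval a f * c - c * aeval a f = 0) : a * c - c * a = 0 := by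
  by_contra hc
  have := degree_symbol_commutator_aeval (fun h' => hc (sub_eq_zero.2 h')) hf hc
  rw [h, map_zero, degree_zero] at this
  exact WithBot.bot_ne_coe this

theorem eq_zero_of_commutator_aeval_eq_smul {a b : WeylAlgebra K} (hab : a * b ≠ b * a)
    {f : K[X]} (hf : 1 < f.natDegree) {r : K} (hr : r ≠ 0) (c : WeylAlgebra K)
    (h : aeval a f * c - c * aeval a f = r • c) : c = 0 := by
  by_contra hc
  have hσ : ∀ c : WeylAlgebra K, c ≠ 0 → symbol K c ≠ 0 := fun c hc => by
    rwa [Ne, map_eq_zero_iff _ symbol_injective]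
  induction hn : (symbol K c).natDegree using Nat.strong_induction_on generalizing c with
  | _ n ih =>
    have he : a * c - c * a ≠ 0 := by
      intro he
      have hac : Commute a c := sub_eq_zero.1 he
      have hfc : Commute (aeval a f) c := commute_aeval hac f
      rw [hfc.eq, sub_self, eq_comm, smul_eq_zero] at h
      exact h.elim hr hc
    have hd := degree_symbol_commutator_aeval (f := f) hab (by omega) he
    have hs : (symbol K (r • c)).degree = n := by
      rw [map_smul, degree_smul_of_smul_regular _ (IsSMulRegular.of_ne_zero hr),
        degree_eq_natDegree (hσ c hc), hn]
    rw [h, hs, Nat.cast_inj] at hd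
    -- At order 0 the descent would stall; but then `f(a)` also has order 0, so its commutator with
    -- `c` has smaller order than `c` and cannot be `r • c`.
    rcases Nat.eq_zero_or_pos (symbol K a).natDegree with h0 | h0
    · have hfa : symbol K (aeval a f) ∈ degreeLT K[X] (0 + 1) := by
        have ha := mem_degreeLT_succ_natDegree (symbol K a)
        rw [h0] at ha
        rw [aeval_eq_sum_range, map_sum]
        refine sum_mem fun k _ => ?_
        rw [map_smul]
        exact ((degreeLT K[X] _).restrictScalars K).smul_mem _ (by simpa using symbol_pow_mem ha k)
      have := symbol_commutator_mem hfa (mem_degreeLT_succ_natDegree (symbol K c))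
      rw [h, mem_degreeLT, hs, hn, zero_add] at this
      exact lt_irrefl _ this
    · refine ih _ ?_ (a * c - c * a) ?_ he rfl
      · have : 0 < (f.natDegree - 1) * (symbol K a).natDegree := Nat.mul_pos (Nat.sub_pos_of_lt hf) h0
        rw [hd]
        exact Nat.lt_add_of_pos_left this
      · have hfa : aeval a f * a = a * aeval a f :=
          (commute_aeval (Commute.refl a) f).eq
        rw [smul_sub, ← mul_smul_comm r a c, ← smul_mul_assoc r c a, ← h]
        simp only [mul_sub, sub_mul, ← mul_assoc, hfa]
        simp only [mul_assoc, hfa]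
        abel

end Commutator

end WeylAlgebra

namespace WeylAlgebra

open Polynomial

/-! ### Passage to the Weyl algebra over an extension field. -/

section BaseChange

variable (K : Type*) [Field K] (L : Type*) [Field L] [Algebra K L]

/-- The map `A₁(K) → A₁(L)` induced by an extension of fields. -/
noncomputable def mapExt : WeylAlgebra K →ₐ[K] WeylAlgebra L :=
  liftGen (genX L) (genD L) genD_mul_genX

/-- The map `L ⊗ A₁(K) → A₁(L)`. -/
noncomputable def ofBaseChange : L ⊗[K] WeylAlgebra K →ₐ[L] WeylAlgebra L :=
  Algebra.TensorProduct.lift (Algebra.ofId L _) (mapExt K L)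
    fun r _ => Algebra.commutes r _

/-- The map `A₁(L) → L ⊗ A₁(K)`. -/
noncomputable def toBaseChange : WeylAlgebra L →ₐ[L] L ⊗[K] WeylAlgebra K :=
  liftGen (1 ⊗ₜ genX K) (1 ⊗ₜ genD K) (by
    rw [Algebra.TensorProduct.tmul_mul_tmul, Algebra.TensorProduct.tmul_mul_tmul, genD_mul_genX,
      TensorProduct.tmul_add, mul_one, Algebra.TensorProduct.one_def])

theorem ofBaseChange_injective : Function.Injective (ofBaseChange K L) := by
  have h : (toBaseChange K L).comp (ofBaseChange K L) = AlgHom.id L _ := by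
    apply Algebra.TensorProduct.ext
    · ext
    · apply algHom_ext_gen <;> simp [toBaseChange, ofBaseChange, mapExt]
  exact Function.LeftInverse.injective (g := toBaseChange K L) fun v => DFunLike.congr_fun h v

theorem ofBaseChange_tmul (r : L) (a : WeylAlgebra K) :
    ofBaseChange K L (r ⊗ₜ a) = r • mapExt K L a :=
  (Algebra.TensorProduct.lift_tmul _ _ _ _ _).trans (Algebra.smul_def _ _).symm

theorem ofBaseChange_one_tmul (a : WeylAlgebra K) :
    ofBaseChange K L (1 ⊗ₜ a) = mapExt K L a := by
  rw [ofBaseChange_tmul, one_smul]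

theorem mapExt_injective : Function.Injective (mapExt K L) := by
  intro a b h
  rw [← ofBaseChange_one_tmul, ← ofBaseChange_one_tmul] at h
  exact Algebra.TensorProduct.includeRight_injective (algebraMap K L).injective
    (ofBaseChange_injective K L h)

/-- Turns eigenvectors in the tensor product into eigenvectors in `A₁(L)`, where the symbol calculus
applies. -/
theorem ofBaseChange_ad (a : WeylAlgebra K) (v : L ⊗[K] WeylAlgebra K) :
    ofBaseChange K L ((Dixmier.ad K (WeylAlgebra K) a).baseChange L v) =
      mapExt K L a * ofBaseChange K L v - ofBaseChange K L v * mapExt K L a := by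
  induction v with
  | zero => simp
  | add v w hv hw => simp only [map_add, hv, hw, mul_add, add_mul]; abel
  | tmul r b =>
    have h : Dixmier.ad K (WeylAlgebra K) a b = a * b - b * a := rfl
    rw [LinearMap.baseChange_tmul, ofBaseChange_tmul, ofBaseChange_tmul, mul_smul_comm,
      smul_mul_assoc, h, map_sub, map_mul, map_mul, smul_sub]

end BaseChange

end WeylAlgebra

namespace Dixmier

/-! ### C, N and D for general endomorphisms. -/

section Endomorphism

variable {K : Type*} [Field K] {A : Type*} [Ring A] [Algebra K A]

/-- Factors are exchanged one at a time: δ(δⁿb) = 0 iff ε(δⁿb) = δⁿ(εb) = 0 iff εⁿ(εb) = 0. -/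
theorem nilAlg_eq_of_commute {δ ε : Module.End K A} (hc : Commute δ ε)
    (hk : kerAlg δ = kerAlg ε) : nilAlg δ = nilAlg ε := by
  have h : ∀ n : ℕ, LinearMap.ker (δ ^ n) = LinearMap.ker (ε ^ n) := by
    intro n
    induction n with
    | zero => rfl
    | succ n ih =>
      ext b
      have hk' : ∀ c, δ c = 0 ↔ ε c = 0 := fun c => SetLike.ext_iff.1 hk c
      have ih' : ∀ c, (δ ^ n) c = 0 ↔ (ε ^ n) c = 0 := fun c => SetLike.ext_iff.1 ih c
      have e : (δ ^ n) (ε b) = ε ((δ ^ n) b) := LinearMap.congr_fun (hc.pow_left n) b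
      rw [LinearMap.mem_ker, LinearMap.mem_ker, pow_succ', pow_succ, Module.End.mul_apply,
        Module.End.mul_apply, hk', ← ih', e]
  simp only [nilAlg, h]

theorem kerAlg_le_eigAlg (δ : Module.End K A) : kerAlg δ ≤ eigAlg δ := by
  intro c hc
  have hc : δ c = 0 := hc
  have h : (1 : AlgebraicClosure K) ⊗ₜ[K] c ∈
      Module.End.eigenspace (δ.baseChange (AlgebraicClosure K)) 0 := by
    rw [Module.End.mem_eigenspace_iff, LinearMap.baseChange_tmul, hc, TensorProduct.tmul_zero,
      zero_smul]
  have hle : Module.End.eigenspace (δ.baseChange (AlgebraicClosure K)) 0 ≤ eigAlgClosure δ :=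
    le_iSup (fun μ => Module.End.eigenspace (δ.baseChange (AlgebraicClosure K)) μ) 0
  exact hle h

theorem eigAlg_smul {r : K} (hr : r ≠ 0) (δ : Module.End K A) : eigAlg (r • δ) = eigAlg δ := by
  have h : ∀ (s : K) (ε : Module.End K A), eigAlgClosure ε ≤ eigAlgClosure (s • ε) := by
    intro s ε
    refine iSup_le fun μ => ?_
    refine le_trans ?_ (le_iSup _ (s • μ))
    intro v hv
    rw [Module.End.mem_eigenspace_iff] at hv ⊢
    rw [LinearMap.baseChange_smul, LinearMap.smul_apply, hv, smul_assoc]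
  have e : eigAlgClosure (r • δ) = eigAlgClosure δ := by
    refine le_antisymm ?_ (h r δ)
    simpa [smul_smul, inv_mul_cancel₀ hr] using h r⁻¹ (r • δ)
  rw [eigAlg, eigAlg, e]

theorem eigAlg_eq_kerAlg {δ : Module.End K A}
    (h : ∀ μ : AlgebraicClosure K, μ ≠ 0 → ∀ v, δ.baseChange (AlgebraicClosure K) v = μ • v →
      v = 0) : eigAlg δ = kerAlg δ := by
  refine le_antisymm ?_ (kerAlg_le_eigAlg δ)
  intro c hc
  have hle : eigAlgClosure δ ≤ LinearMap.ker (δ.baseChange (AlgebraicClosure K)) := by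
    refine iSup_le fun μ v hv => ?_
    rw [Module.End.mem_eigenspace_iff] at hv
    by_cases hμ : μ = 0
    · rw [LinearMap.mem_ker, hv, hμ, zero_smul]
    · rw [h μ hμ v hv]
      exact zero_mem _
  have h0 : (1 : AlgebraicClosure K) ⊗ₜ[K] δ c = 0 := by
    have : δ.baseChange (AlgebraicClosure K) (1 ⊗ₜ c) = 0 := hle hc
    simpa using this
  have h1 : (1 : AlgebraicClosure K) ⊗ₜ[K] δ c = 1 ⊗ₜ 0 := by
    rw [h0, TensorProduct.tmul_zero]
  exact Algebra.TensorProduct.includeRight_injective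
    (algebraMap K (AlgebraicClosure K)).injective h1

end Endomorphism

/-! ### C, N and D of `f(a)` in the Weyl algebra. -/

section Weyl

open Polynomial

theorem ad_apply {K : Type*} [Field K] {A : Type*} [Ring A] [Algebra K A] (a b : A) :
    ad K A a b = a * b - b * a := rfl

theorem mem_kerAlg_ad {K : Type*} [Field K] {A : Type*} [Ring A] [Algebra K A] {a b : A} :
    b ∈ kerAlg (ad K A a) ↔ Commute a b := sub_eq_zero

theorem notMem_center_iff {K : Type*} [Field K] {A : Type*} [Ring A] [Algebra K A] {a : A} :
    a ∉ Subalgebra.center K A ↔ kerAlg (ad K A a) ≠ ⊤ := by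
  rw [Ne, Submodule.eq_top_iff', not_iff_not, Subalgebra.mem_center_iff]
  exact forall_congr' fun b => eq_comm.trans mem_kerAlg_ad.symm

theorem commute_ad {K : Type*} [Field K] {A : Type*} [Ring A] [Algebra K A] {a b : A}
    (h : Commute a b) : Commute (ad K A a) (ad K A b) := by
  refine LinearMap.ext fun c => ?_
  simp only [Module.End.mul_apply, ad_apply, mul_sub, sub_mul, ← mul_assoc, h.eq]
  simp only [mul_assoc, h.eq]
  abel

variable {K : Type*} [Field K]

theorem eigAlg_ad_aeval_of_natDegree_eq_one {A : Type*} [Ring A] [Algebra K A] (a : A) {f : K[X]}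
    (hf : f.natDegree = 1) : eigAlg (ad K _ (aeval a f)) = eigAlg (ad K _ a) := by
  obtain ⟨r, hr, s, rfl⟩ := natDegree_eq_one.1 hf
  have e : ad K A (aeval a (C r * X + C s)) = r • ad K _ a := by
    refine LinearMap.ext fun c => ?_
    simp only [ad_apply, LinearMap.smul_apply, map_add, map_mul, aeval_C, aeval_X, add_mul,
      mul_add, ← Algebra.smul_def, mul_smul_comm, smul_sub, smul_mul_assoc]
    rw [← Algebra.commutes s c, ← Algebra.smul_def]
    abel
  rw [e, eigAlg_smul hr]

variable [CharZero K]

theorem kerAlg_ad_aeval (a : WeylAlgebra K) {f : K[X]} (hf : 0 < f.natDegree) :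
    kerAlg (ad K _ (aeval a f)) = kerAlg (ad K _ a) := by
  ext c
  rw [mem_kerAlg_ad, mem_kerAlg_ad]
  exact ⟨fun h => sub_eq_zero.1 (WeylAlgebra.commute_of_commute_aeval hf (sub_eq_zero.2 h)),
    fun h => WeylAlgebra.commute_aeval h f⟩

theorem nilAlg_ad_aeval (a : WeylAlgebra K) {f : K[X]} (hf : 0 < f.natDegree) :
    nilAlg (ad K _ (aeval a f)) = nilAlg (ad K _ a) :=
  nilAlg_eq_of_commute (commute_ad (WeylAlgebra.commute_aeval (Commute.refl a) f))
    (kerAlg_ad_aeval a hf)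

theorem eigAlg_ad_aeval {a : WeylAlgebra K} (ha : a ∉ Subalgebra.center K (WeylAlgebra K))
    {f : K[X]} (hf : 1 < f.natDegree) :
    eigAlg (ad K _ (aeval a f)) = kerAlg (ad K _ a) := by
  rw [← kerAlg_ad_aeval a (zero_lt_one.trans hf)]
  refine eigAlg_eq_kerAlg fun μ hμ v hv => ?_
  obtain ⟨b, hb⟩ : ∃ b, a * b ≠ b * a := by
    rw [Subalgebra.mem_center_iff] at ha
    push Not at ha
    exact ha.imp fun b hb => hb.symm
  set L := AlgebraicClosure K
  have hb' : WeylAlgebra.mapExt K L a * WeylAlgebra.mapExt K L b ≠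
      WeylAlgebra.mapExt K L b * WeylAlgebra.mapExt K L a := by
    rw [← map_mul, ← map_mul]
    exact fun h => hb (WeylAlgebra.mapExt_injective K L h)
  have hv' := congrArg (WeylAlgebra.ofBaseChange K L) hv
  rw [WeylAlgebra.ofBaseChange_ad, map_smul, ← aeval_algHom_apply,
    ← aeval_map_algebraMap L] at hv'
  refine WeylAlgebra.ofBaseChange_injective K L ?_
  rw [map_zero]
  exact WeylAlgebra.eq_zero_of_commutator_aeval_eq_smul hb' (by rwa [natDegree_map]) hμ _ hv'

end Weyl

end Dixmier

theorem mainTheorem3 (K : Type*) [Field K] [CharZero K] :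
    (∀ a ∈ Dixmier.Delta₅ K (WeylAlgebra K), ∀ b ∈ Algebra.adjoin K {a},
      b ∉ Set.range (algebraMap K (WeylAlgebra K)) → b ∈ Dixmier.Delta₅ K (WeylAlgebra K)) ∧
    (∀ (f : Polynomial K), 1 < f.natDegree → ∀ a : WeylAlgebra K,
      (a ∈ Dixmier.Delta₁ K (WeylAlgebra K) →
        Polynomial.aeval a f ∈ Dixmier.Delta₁ K (WeylAlgebra K)) ∧
      (a ∈ Dixmier.Delta₂ K (WeylAlgebra K) →
        Polynomial.aeval a f ∈ Dixmier.Delta₂ K (WeylAlgebra K)) ∧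
      (a ∈ Dixmier.Delta₃ K (WeylAlgebra K) →
        Polynomial.aeval a f ∈ Dixmier.Delta₅ K (WeylAlgebra K)) ∧
      (a ∈ Dixmier.Delta₄ K (WeylAlgebra K) →
        Polynomial.aeval a f ∈ Dixmier.Delta₅ K (WeylAlgebra K)) ∧
      (a ∈ Dixmier.Delta₅ K (WeylAlgebra K) →
        Polynomial.aeval a f ∈ Dixmier.Delta₅ K (WeylAlgebra K))) := by
  have main : ∀ (f : Polynomial K), 1 < f.natDegree → ∀ a : WeylAlgebra K,
      a ∉ Subalgebra.center K (WeylAlgebra K) →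
      Polynomial.aeval a f ∉ Subalgebra.center K (WeylAlgebra K) ∧
      Dixmier.kerAlg (Dixmier.ad K _ (Polynomial.aeval a f)) = Dixmier.kerAlg (Dixmier.ad K _ a) ∧
      Dixmier.nilAlg (Dixmier.ad K _ (Polynomial.aeval a f)) = Dixmier.nilAlg (Dixmier.ad K _ a) ∧
      Dixmier.eigAlg (Dixmier.ad K _ (Polynomial.aeval a f)) =
        Dixmier.kerAlg (Dixmier.ad K _ a) := by
    intro f hf a ha
    have hk := Dixmier.kerAlg_ad_aeval a (zero_lt_one.trans hf)
    refine ⟨?_, hk, Dixmier.nilAlg_ad_aeval a (zero_lt_one.trans hf),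
      Dixmier.eigAlg_ad_aeval ha hf⟩
    rwa [Dixmier.notMem_center_iff, hk, ← Dixmier.notMem_center_iff]
  refine ⟨?_, fun f hf a => ⟨?_, ?_, ?_, ?_, ?_⟩⟩
  · rintro a ⟨ha, hN, hD⟩ b hb hbK
    rw [Algebra.adjoin_singleton_eq_range_aeval] at hb
    obtain ⟨f, rfl⟩ := hb
    replace hbK : Polynomial.aeval a f ∉ Set.range (algebraMap K (WeylAlgebra K)) := hbK
    show Polynomial.aeval a f ∈ _
    -- Degree 0 gives a scalar, and degree 1 merely rescales `ad a`; the collapse of D needs degree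
    -- above 1.
    rcases lt_trichotomy f.natDegree 1 with hf | hf | hf
    · rw [Polynomial.eq_C_of_natDegree_eq_zero (Nat.lt_one_iff.1 hf), Polynomial.aeval_C] at hbK
      exact absurd ⟨_, rfl⟩ hbK
    · have hf0 : 0 < f.natDegree := by omega
      have hk := Dixmier.kerAlg_ad_aeval a hf0
      refine ⟨?_, ?_, ?_⟩
      · rwa [Dixmier.notMem_center_iff, hk, ← Dixmier.notMem_center_iff]
      · rw [Dixmier.nilAlg_ad_aeval a hf0, Dixmier.eigAlg_ad_aeval_of_natDegree_eq_one a hf, hN]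
      · rw [Dixmier.eigAlg_ad_aeval_of_natDegree_eq_one a hf, hk, hD]
    · obtain ⟨h0, hk, hn, he⟩ := main f hf a ha
      exact ⟨h0, by rw [hn, he, hN, hD], by rw [he, hk]⟩
  · rintro ⟨ha, hN, hD⟩
    obtain ⟨h0, hk, hn, he⟩ := main f hf a ha
    exact ⟨h0, by rw [hn, hN], by rw [he, hk]⟩
  · rintro ⟨ha, hN, hN', hD⟩
    obtain ⟨h0, hk, hn, he⟩ := main f hf a ha
    exact ⟨h0, by rwa [hn, hk], by rwa [hn], by rw [he, hk]⟩
  · rintro ⟨ha, hN, hD⟩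
    obtain ⟨h0, hk, hn, he⟩ := main f hf a ha
    exact ⟨h0, by rw [hn, he, hN], by rw [he, hk]⟩
  · rintro ⟨ha, hN, -⟩
    obtain ⟨h0, hk, hn, he⟩ := main f hf a ha
    exact ⟨h0, by rw [hn, he, hN], by rw [he, hk]⟩
  · rintro ⟨ha, hN, hD⟩
    obtain ⟨h0, hk, hn, he⟩ := main f hf a ha
    exact ⟨h0, by rw [hn, he, hN, hD], by rw [he, hk]⟩
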